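/- Let $T$ be a locally compact Hausdorff space with a bounded (finite) Radon measure $\mu$, let $\mathscr{A}$ be a unital $C^*$-algebra with unit $I$, and let $1<r\le 2$. Let $a:T\to\mathbb{R}$ be a bounded continuous nonnegative function with $$\int_T a(t)^{\frac{1}{1-r}}\,d\mu(t)<\infty ,$$ where $a(t)^{\frac1{1-r}}=+\infty$ if $a(t)=0$ (so that $a>0$ $\mu$-almost everywhere). Let $(X_t)_{t\in T}$ be a bounded norm-continuous field of elements of $\mathscr{A}$ satisfying $$\int_T a(t)^{\frac{1}{1-r}}X_t^*X_t\,d\mu(t)\ \le\ \int_T a(t)^{\frac{1}{1-r}}\,d\mu(t)\; I .$$ Then for every norm-continuous field $(A_t)_{t\in T}$ of positive elements of $\mathscr{A}$ for which $t\mapsto a(t)X_t^*A_t^rX_t$ is Bochner integrable (which is automatic if $(A_t)$ is bounded), the function $t\mapsto X_t^*A_tX_t$ is Bochner integrable and $$\left(\int_T X_t^*A_tX_t\,d\mu(t)\right)^{r}\ \le\ \left(\int_T a(t)^{\frac{1}{1-r}}\,d\mu(t)\right)^{r-1}\int_T a(t)\,X_t^*A_t^rX_t\,d\mu(t).$$ Here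 the integrals of $\mathscr{A}$-valued functions are Bochner integrals. -/

import Mathlib

open MeasureTheory
open scoped ENNReal

/-! With w = a^(1/(1-r)) and W = ∫ w, the claim is operator Jensen for x ↦ x^r, applied to w⁻¹A and
Z = √(w/W) X: the hypothesis says ∫ Z*Z ≤ 1, and w·w^(-r) = a restores the weight.

Jensen comes from a supporting linear form. For 1 < r < 2, A^r is an integral over s > 0 of s^(r-2)
A(s+A)⁻¹A. Expanding N*(s+A)⁻¹N ≥ 0 with N = AZ - (s+A)ZD bounds Z*A(s+A)⁻¹AZ below by a form linear
in (Z*AZ, Z*Z) (`supportForm_conj_le`). With D = B(s+B)⁻¹ the form is sharp at (B, 1)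
(`le_supportForm`). Integrating in s gives a bounded linear Φ (`exists_support_rpow`), which
commutes with Bochner integrals over T; B is taken to be ∫ Z*AZ. -/

section SupportForm

variable {𝒜 : Type*} [CStarAlgebra 𝒜]

/-- The linear function of `(P, Q)` that supports `A ↦ A² (s + A)⁻¹`. -/
noncomputable def supportForm (s : ℝ) (D : 𝒜) : 𝒜 × 𝒜 →L[ℝ] 𝒜 :=
  (ContinuousLinearMap.mulLeftRight ℝ 𝒜 1 D + ContinuousLinearMap.mulLeftRight ℝ 𝒜 D 1
    - ContinuousLinearMap.mulLeftRight ℝ 𝒜 D D).comp (ContinuousLinearMap.fst ℝ 𝒜 𝒜)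
  - s • (ContinuousLinearMap.mulLeftRight ℝ 𝒜 D D).comp (ContinuousLinearMap.snd ℝ 𝒜 𝒜)

lemma supportForm_apply (s : ℝ) (D P Q : 𝒜) :
    supportForm s D (P, Q) = P * D + D * P - D * P * D - s • (D * Q * D) := by
  simp [supportForm]

lemma norm_supportForm_le {s : ℝ} (hs : 0 ≤ s) (D : 𝒜) :
    ‖supportForm s D‖ ≤ 2 * ‖D‖ + ‖D‖ * ‖D‖ + s * (‖D‖ * ‖D‖) := by
  refine ContinuousLinearMap.opNorm_le_bound _ (by positivity) fun ⟨P, Q⟩ => ?_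
  have hP : ‖P‖ ≤ ‖(P, Q)‖ := le_max_left _ _
  have hQ : ‖Q‖ ≤ ‖(P, Q)‖ := le_max_right _ _
  rw [supportForm_apply]
  calc _ ≤ ‖P‖ * ‖D‖ + ‖D‖ * ‖P‖ + ‖D‖ * ‖P‖ * ‖D‖ + s * (‖D‖ * ‖Q‖ * ‖D‖) := by
        refine (norm_sub_le _ _).trans (add_le_add ((norm_sub_le _ _).trans (add_le_add
          ((norm_add_le _ _).trans (add_le_add (norm_mul_le _ _) (norm_mul_le _ _)))
          (norm_mul₃_le))) ?_)
        rw [norm_smul, Real.norm_of_nonneg hs]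
        gcongr
        exact norm_mul₃_le
    _ ≤ ‖(P, Q)‖ * ‖D‖ + ‖D‖ * ‖(P, Q)‖ + ‖D‖ * ‖(P, Q)‖ * ‖D‖
        + s * (‖D‖ * ‖(P, Q)‖ * ‖D‖) := by gcongr
    _ = _ := by ring

end SupportForm

/-! ### Resolvents and the support inequality for fixed s. -/

section CFC

variable {𝒜 : Type*} [CStarAlgebra 𝒜] [PartialOrder 𝒜] [StarOrderedRing 𝒜]

lemma add_pos_of_mem_spectrum {A : 𝒜} (hA : 0 ≤ A) {s : ℝ} (hs : 0 < s) {x : ℝ}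
    (hx : x ∈ spectrum ℝ A) : 0 < s + x :=
  add_pos_of_pos_of_nonneg hs (spectrum_nonneg_of_nonneg hA hx)

lemma continuousOn_inv_add_spectrum {A : 𝒜} (hA : 0 ≤ A) {s : ℝ} (hs : 0 < s) :
    ContinuousOn (fun x : ℝ => (s + x)⁻¹) (spectrum ℝ A) :=
  ContinuousOn.inv₀ (by fun_prop) fun _ hx => (add_pos_of_mem_spectrum hA hs hx).ne'

/-- The resolvent `(s + A)⁻¹`, by functional calculus. -/
noncomputable def cfcResolvent (s : ℝ) (A : 𝒜) : 𝒜 := cfc (fun x : ℝ => (s + x)⁻¹) A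

lemma cfcResolvent_nonneg {A : 𝒜} (hA : 0 ≤ A) {s : ℝ} (hs : 0 < s) :
    0 ≤ cfcResolvent s A :=
  cfc_nonneg fun _ hx => (inv_pos.2 (add_pos_of_mem_spectrum hA hs hx)).le

lemma cfc_add_id {A : 𝒜} (hA : 0 ≤ A) (s : ℝ) :
    cfc (fun x : ℝ => s + x) A = s • (1 : 𝒜) + A := by
  rw [cfc_const_add s (fun x => x) A, cfc_id' ℝ A, Algebra.algebraMap_eq_smul_one]

lemma cfcResolvent_mul_add {A : 𝒜} (hA : 0 ≤ A) {s : ℝ} (hs : 0 < s) :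
    cfcResolvent s A * (s • 1 + A) = 1 := by
  have hc := continuousOn_inv_add_spectrum hA hs
  rw [← cfc_add_id hA, cfcResolvent, ← cfc_mul (fun x : ℝ => (s + x)⁻¹) (fun x => s + x) A,
    ← cfc_one ℝ A]
  exact cfc_congr fun x hx => inv_mul_cancel₀ (add_pos_of_mem_spectrum hA hs hx).ne'

lemma add_mul_cfcResolvent {A : 𝒜} (hA : 0 ≤ A) {s : ℝ} (hs : 0 < s) :
    (s • 1 + A) * cfcResolvent s A = 1 := by
  have hc := continuousOn_inv_add_spectrum hA hs
  rw [← cfc_add_id hA, cfcResolvent, ← cfc_mul (fun x => s + x) (fun x : ℝ => (s + x)⁻¹) A,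
    ← cfc_one ℝ A]
  exact cfc_congr fun x hx => mul_inv_cancel₀ (add_pos_of_mem_spectrum hA hs hx).ne'

lemma mul_cfcResolvent_eq_cfc {A : 𝒜} (hA : 0 ≤ A) {s : ℝ} (hs : 0 < s) :
    A * cfcResolvent s A = cfc (fun x : ℝ => x * (s + x)⁻¹) A := by
  have hc := continuousOn_inv_add_spectrum hA hs
  rw [cfc_mul (fun x : ℝ => x) (fun x : ℝ => (s + x)⁻¹) A, cfc_id' ℝ A, cfcResolvent]

lemma commute_cfcResolvent {A : 𝒜} (hA : 0 ≤ A) (s : ℝ) : Commute A (cfcResolvent s A) := by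
  have := cfc_commute_cfc (R := ℝ) (fun x => x) (fun x : ℝ => (s + x)⁻¹) A
  rwa [cfc_id' ℝ A] at this

lemma norm_mul_cfcResolvent_le [Nontrivial 𝒜] {A : 𝒜} (hA : 0 ≤ A) {s b : ℝ} (hs : 0 < s)
    (hb : ‖A‖ ≤ b) : ‖A * cfcResolvent s A‖ ≤ b * (s + b)⁻¹ := by
  have hb0 : 0 ≤ b := (norm_nonneg A).trans hb
  rw [mul_cfcResolvent_eq_cfc hA hs]
  refine norm_cfc_le (by positivity) fun x hx => ?_
  have hx0 : 0 ≤ x := spectrum_nonneg_of_nonneg hA hx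
  have hxb : x ≤ b := (Real.le_norm_self x).trans ((spectrum.norm_le_norm_of_mem hx).trans hb)
  rw [Real.norm_of_nonneg (by positivity), ← div_eq_mul_inv, ← div_eq_mul_inv,
    div_le_div_iff₀ (by positivity) (by positivity)]
  nlinarith

lemma continuousOn_cfcResolvent {A : 𝒜} (hA : 0 ≤ A) :
    ContinuousOn (fun s => cfcResolvent s A) (Set.Ioi 0) := by
  have h : ∀ s ∈ Set.Ioi (0 : ℝ), cfcResolvent s A = Ring.inverse (s • 1 + A) := fun s hs =>
    (Ring.inverse_unit ⟨s • 1 + A, cfcResolvent s A, add_mul_cfcResolvent hA hs,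
      cfcResolvent_mul_add hA hs⟩).symm
  refine ContinuousOn.congr (fun s hs => ContinuousAt.continuousWithinAt ?_) h
  refine ContinuousAt.comp (f := fun s : ℝ => s • (1 : 𝒜) + A) (g := Ring.inverse) ?_
    (by fun_prop)
  exact NormedRing.inverse_continuousAt ⟨s • 1 + A, cfcResolvent s A, add_mul_cfcResolvent hA hs,
      cfcResolvent_mul_add hA hs⟩

lemma cfcₙ_rpowIntegrand₁₂_eq {A : 𝒜} (hA : 0 ≤ A) {r s : ℝ} (hs : 0 < s) :
    cfcₙ (Real.rpowIntegrand₁₂ r s) A = s ^ (r - 2) • (A * cfcResolvent s A * A) := by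
  have hc := continuousOn_inv_add_spectrum hA hs
  have hq : ∀ x ∈ quasispectrum ℝ A, 0 < s + x := fun x hx =>
    add_pos_of_pos_of_nonneg hs (quasispectrum_nonneg_of_nonneg A hA x hx)
  have hcq : ContinuousOn (Real.rpowIntegrand₁₂ r s) (quasispectrum ℝ A) := by
    have : ContinuousOn (fun x : ℝ => (s + x)⁻¹) (quasispectrum ℝ A) :=
      ContinuousOn.inv₀ (by fun_prop) fun x hx => (hq x hx).ne'
    unfold Real.rpowIntegrand₁₂
    fun_prop
  rw [cfcₙ_eq_cfc hcq (Real.rpowIntegrand₁₂_zero hs), mul_cfcResolvent_eq_cfc hA hs]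
  nth_rw 3 [← cfc_id' ℝ A]
  rw [← cfc_mul .., ← cfc_smul ..]
  refine cfc_congr fun x hx => ?_
  have h := (add_pos_of_mem_spectrum hA hs hx).ne'
  have h2 : s ^ (r - 1) = s ^ (r - 2) * s := by
    rw [← Real.rpow_add_one hs.ne']; ring_nf
  simp only [Real.rpowIntegrand₁₂, h2, smul_eq_mul]
  field_simp
  ring

/-- The difference of the two sides is N*GN with N = AZ - (s+A)ZD; the cross terms lose G because it
inverts s + A. -/
lemma supportForm_conj_le {A D : 𝒜} (hA : 0 ≤ A) (hD : star D = D) {s : ℝ} (hs : 0 < s) (Z : 𝒜) :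
    supportForm s D (star Z * A * Z, star Z * Z) ≤
      star Z * (A * cfcResolvent s A * A) * Z := by
  set G := cfcResolvent s A
  have hA' : star A = A := (IsSelfAdjoint.of_nonneg hA).star_eq
  have h1 : G * (s • 1 + A) = 1 := cfcResolvent_mul_add hA hs
  have h2 : (s • 1 + A) * G = 1 := add_mul_cfcResolvent hA hs
  have key := star_left_conjugate_nonneg (cfcResolvent_nonneg hA hs) (A * Z - (s • 1 + A) * Z * D)
  have h3 : star (A * Z - (s • 1 + A) * Z * D) = star Z * A - D * star Z * (s • 1 + A) := by
    simp [hA', hD, mul_assoc]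
  rw [h3] at key
  rw [← sub_nonneg, supportForm_apply]
  convert key using 1
  calc _ = star Z * A * G * A * Z - star Z * A * Z * D - D * star Z * A * Z
        + D * star Z * (s • 1 + A) * Z * D := by
        simp only [mul_add, add_mul, smul_mul_assoc, mul_smul_comm, mul_one, mul_assoc]
        abel
    _ = star Z * A * G * A * Z - star Z * A * (G * (s • 1 + A)) * Z * D
        - D * star Z * ((s • 1 + A) * G) * A * Z
        + D * star Z * ((s • 1 + A) * G) * (s • 1 + A) * Z * D := by
        rw [h1, h2]; simp only [mul_one]
    _ = _ := by
        simp only [sub_mul, mul_sub, mul_assoc]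
        abel

/-- Since D(s+B) = B, equality holds at Q = 1. The form is decreasing in Q, so Q ≤ 1 suffices. -/
lemma le_supportForm {B Q : 𝒜} (hB : 0 ≤ B) {s : ℝ} (hs : 0 < s) (hQ : Q ≤ 1) :
    B * cfcResolvent s B * B ≤ supportForm s (B * cfcResolvent s B) (B, Q) := by
  set G := cfcResolvent s B
  set D := B * G with hDdef
  have hc : B * G = G * B := commute_cfcResolvent hB s
  have h2 : (s • 1 + B) * G = 1 := add_mul_cfcResolvent hB hs
  have hD : IsSelfAdjoint D := by
    rw [hDdef, mul_cfcResolvent_eq_cfc hB hs]; exact cfc_predicate _ _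
  have h3 : D * B + s • D = B := by
    calc D * B + s • D = B * ((s • 1 + B) * G) := by
          rw [hDdef, mul_assoc, ← hc, add_mul, mul_add, smul_mul_assoc, one_mul, mul_smul_comm]
          abel
      _ = B := by rw [h2, mul_one]
  have h4 : s • (D * Q * D) ≤ s • (D * D) := by
    have := hD.conjugate_le_conjugate hQ
    rw [mul_one] at this
    exact smul_le_smul_of_nonneg_left this hs.le
  have hBD : B * D = D * B := by rw [hDdef, mul_assoc, ← hc, ← mul_assoc]
  rw [supportForm_apply, hBD]
  calc D * B = D * B + D * B - D * B * D - s • (D * D) := by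
        have : D * B * D + s • (D * D) = D * B := by
          rw [← smul_mul_assoc, ← add_mul, h3, hBD]
        rw [sub_sub, this, add_sub_cancel_right]
    _ ≤ _ := sub_le_sub_left h4 _

lemma continuousOn_supportForm {B : 𝒜} (hB : 0 ≤ B) :
    ContinuousOn (fun s => supportForm s (B * cfcResolvent s B)) (Set.Ioi 0) := by
  have := continuousOn_cfcResolvent hB
  unfold supportForm
  fun_prop

end CFC

/-! ### Integration over s and operator Jensen. -/

section Jensen

variable {𝒜 : Type*} [CStarAlgebra 𝒜] [PartialOrder 𝒜] [StarOrderedRing 𝒜]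

/-- The factor b/(s+b) is the one in the integrand of (b•1)^r, whose known integrability then
dominates the forms. -/
lemma norm_supportForm_mul_cfcResolvent_le [Nontrivial 𝒜] {B : 𝒜} (hB : 0 ≤ B) {s b : ℝ}
    (hs : 0 < s) (hb : 0 < b) (hBb : ‖B‖ ≤ b) :
    ‖supportForm s (B * cfcResolvent s B)‖ ≤ (3 + b) * (b * (s + b)⁻¹) := by
  have hd := norm_mul_cfcResolvent_le hB hs hBb
  refine (norm_supportForm_le hs.le _).trans ?_
  set d := ‖B * cfcResolvent s B‖
  have hd0 : 0 ≤ d := norm_nonneg _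
  have h1 : b * (s + b)⁻¹ ≤ 1 := by
    rw [← div_eq_mul_inv, div_le_one (by positivity)]; linarith
  have h2 : s * d ≤ b := by
    refine (mul_le_mul_of_nonneg_left hd hs.le).trans ?_
    rw [← div_eq_mul_inv, mul_div_assoc', div_le_iff₀ (by positivity)]
    nlinarith
  calc 2 * d + d * d + s * (d * d) = (2 + d + s * d) * d := by ring
    _ ≤ (2 + 1 + b) * (b * (s + b)⁻¹) := by gcongr; exact hd.trans h1
    _ = _ := by ring

lemma norm_cfcₙ_rpowIntegrand₁₂_smul_one [Nontrivial 𝒜] {r s b : ℝ} (hs : 0 < s) (hb : 0 < b) :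
    ‖cfcₙ (Real.rpowIntegrand₁₂ r s) (b • (1 : 𝒜))‖ = s ^ (r - 2) * (b * (b * (s + b)⁻¹)) := by
  have hb1 : 0 ≤ b • (1 : 𝒜) := smul_nonneg hb.le zero_le_one
  have h : cfcResolvent s (b • (1 : 𝒜)) = (s + b)⁻¹ • 1 := by
    have := cfcResolvent_mul_add hb1 hs
    rw [← add_smul, mul_smul_comm, mul_one] at this
    rw [← inv_smul_smul₀ (by positivity : s + b ≠ 0) (cfcResolvent s (b • (1 : 𝒜))), this]
  rw [cfcₙ_rpowIntegrand₁₂_eq hb1 hs, h]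
  simp only [smul_mul_smul_comm, mul_one, smul_smul, norm_smul, norm_one]
  rw [Real.norm_of_nonneg (by positivity)]
  ring

/-- The operator convex function `A ↦ A ^ r` is supported at `B` by a linear function of the
compressions `star Z * A * Z` and `star Z * Z`. -/
lemma exists_support_rpow {r : ℝ} (hr₁ : 1 < r) (hr₂ : r ≤ 2) {B : 𝒜} (hB : 0 ≤ B) :
    ∃ Φ : 𝒜 × 𝒜 →L[ℝ] 𝒜, (∀ Q ≤ 1, B ^ r ≤ Φ (B, Q)) ∧
      ∀ A Z : 𝒜, 0 ≤ A → Φ (star Z * A * Z, star Z * Z) ≤ star Z * A ^ r * Z := by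
  nontriviality 𝒜
  have hBs : star B = B := (IsSelfAdjoint.of_nonneg hB).star_eq
  -- The integral representation needs r < 2; for r = 2 the support form comes from (AZ - ZB)*(AZ -
  -- ZB) ≥ 0.
  rcases hr₂.eq_or_lt with rfl | hr₂
  · have hpow : ∀ A : 𝒜, 0 ≤ A → A ^ (2 : ℝ) = A * A := fun A hA => by
      rw [← pow_two, ← CFC.rpow_natCast A 2 hA]; norm_num
    refine ⟨(ContinuousLinearMap.mulLeftRight ℝ 𝒜 1 B
      + ContinuousLinearMap.mulLeftRight ℝ 𝒜 B 1).comp (ContinuousLinearMap.fst ℝ 𝒜 𝒜)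
      - (ContinuousLinearMap.mulLeftRight ℝ 𝒜 B B).comp (ContinuousLinearMap.snd ℝ 𝒜 𝒜), ?_, ?_⟩
    · intro Q hQ
      have := (IsSelfAdjoint.of_nonneg hB).conjugate_le_conjugate hQ
      rw [hpow B hB]
      simp only [sub_apply, add_apply, one_mul,
        ContinuousLinearMap.comp_apply, ContinuousLinearMap.coe_fst',
        ContinuousLinearMap.coe_snd', ContinuousLinearMap.mulLeftRight_apply, mul_one]
      rw [mul_one] at this
      rw [add_sub_assoc]
      exact le_add_of_nonneg_right (sub_nonneg.2 this)
    · intro A Z hA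
      have hA' : star A = A := (IsSelfAdjoint.of_nonneg hA).star_eq
      have key := star_mul_self_nonneg (A * Z - Z * B)
      rw [hpow A hA, ← sub_nonneg]
      convert key using 1
      simp only [sub_apply, add_apply, one_mul,
        ContinuousLinearMap.comp_apply, ContinuousLinearMap.coe_fst',
        ContinuousLinearMap.coe_snd', ContinuousLinearMap.mulLeftRight_apply, mul_one,
        star_sub, star_mul, hA', hBs, sub_mul, mul_sub, mul_assoc]
      abel
  · lift r to NNReal using by linarith
    have hr : r ∈ Set.Ioo 1 2 := ⟨by exact_mod_cast hr₁, by exact_mod_cast hr₂⟩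
    obtain ⟨ν, hν⟩ := CFC.exists_measure_nnrpow_eq_integral_cfcₙ_rpowIntegrand₁₂ 𝒜 hr
    have hpow : ∀ A : 𝒜, 0 ≤ A → IntegrableOn (fun s => s ^ ((r : ℝ) - 2) •
        (A * cfcResolvent s A * A)) (Set.Ioi 0) ν ∧
        A ^ (r : ℝ) = ∫ s in Set.Ioi 0, s ^ ((r : ℝ) - 2) • (A * cfcResolvent s A * A) ∂ν := by
      intro A hA
      have he : Set.EqOn (fun s => cfcₙ (Real.rpowIntegrand₁₂ r s) A)
          (fun s => s ^ ((r : ℝ) - 2) • (A * cfcResolvent s A * A)) (Set.Ioi 0) :=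
        fun s hs => cfcₙ_rpowIntegrand₁₂_eq hA hs
      rw [← CFC.nnrpow_eq_rpow (zero_lt_one.trans hr.1),
        ← setIntegral_congr_fun measurableSet_Ioi he,
        ← integrableOn_congr_fun he measurableSet_Ioi]
      exact hν A hA
    -- The added 1 keeps b positive even when B = 0, so that dividing by b is legitimate.
    set b := ‖B‖ + 1
    have hb : 0 < b := by positivity
    have hint : IntegrableOn (fun s => s ^ ((r : ℝ) - 2) • supportForm s (B * cfcResolvent s B))
        (Set.Ioi 0) ν := by
      have hi := ((hν (b • 1) (smul_nonneg hb.le zero_le_one)).1.norm).const_mul ((3 + b) / b)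
      refine hi.mono' (ContinuousOn.aestronglyMeasurable ?_ measurableSet_Ioi) ?_
      · refine ContinuousOn.smul (f := fun s : ℝ => s ^ ((r : ℝ) - 2)) ?_
          (continuousOn_supportForm hB)
        exact ContinuousOn.rpow_const (f := fun s : ℝ => s) continuousOn_id fun s hs => Or.inl (ne_of_gt hs)
      · filter_upwards [ae_restrict_mem measurableSet_Ioi] with s hs
        have hs : 0 < s := hs
        rw [norm_cfcₙ_rpowIntegrand₁₂_smul_one hs hb, norm_smul,
          Real.norm_of_nonneg (by positivity)]
        calc _ ≤ s ^ ((r : ℝ) - 2) * ((3 + b) * (b * (s + b)⁻¹)) := by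
              gcongr
              exact norm_supportForm_mul_cfcResolvent_le hB hs hb (by simp [b])
          _ = _ := by field_simp
    have happ : ∀ v, IntegrableOn (fun s => s ^ ((r : ℝ) - 2) •
        supportForm s (B * cfcResolvent s B) v) (Set.Ioi 0) ν := fun v =>
      (ContinuousLinearMap.apply ℝ 𝒜 v).integrable_comp hint
    refine ⟨∫ s in Set.Ioi 0, s ^ ((r : ℝ) - 2) • supportForm s (B * cfcResolvent s B) ∂ν, ?_, ?_⟩
    · intro Q hQ
      rw [ContinuousLinearMap.integral_apply hint, (hpow B hB).2]
      refine setIntegral_mono_on (hpow B hB).1 (happ _) measurableSet_Ioi fun s hs => ?_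
      exact smul_le_smul_of_nonneg_left (le_supportForm hB hs hQ) (Real.rpow_nonneg (le_of_lt hs) _)
    · intro A Z hA
      let L : 𝒜 →L[ℝ] 𝒜 := ContinuousLinearMap.mulLeftRight ℝ 𝒜 (star Z) Z
      have hL : ∀ Y, L Y = star Z * Y * Z := fun Y => by simp [L]
      rw [ContinuousLinearMap.integral_apply hint, (hpow A hA).2,
        ← hL (∫ s in Set.Ioi 0, _ ∂ν), ← L.integral_comp_comm (hpow A hA).1]
      refine setIntegral_mono_on (happ _) (L.integrable_comp (hpow A hA).1) measurableSet_Ioi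
        fun s hs => ?_
      rw [hL, mul_smul_comm, smul_mul_assoc, smul_apply]
      refine smul_le_smul_of_nonneg_left (supportForm_conj_le hA ?_ hs Z)
        (Real.rpow_nonneg (le_of_lt hs) _)
      rw [mul_cfcResolvent_eq_cfc hB hs]
      exact (cfc_predicate (R := ℝ) (p := IsSelfAdjoint) _ _).star_eq

/-- The operator Jensen inequality for `A ↦ A ^ r`, `1 < r ≤ 2`, and a field of compressions. -/
theorem rpow_integral_conj_le {T : Type*} [MeasurableSpace T] {μ : Measure T} {r : ℝ}
    (hr₁ : 1 < r) (hr₂ : r ≤ 2) {A Z : T → 𝒜} (hA : ∀ t, 0 ≤ A t)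
    (hZ : Integrable (fun t => star (Z t) * Z t) μ) (hZ1 : ∫ t, star (Z t) * Z t ∂μ ≤ 1)
    (hZA : Integrable (fun t => star (Z t) * A t * Z t) μ)
    (hZAr : Integrable (fun t => star (Z t) * A t ^ r * Z t) μ) :
    (∫ t, star (Z t) * A t * Z t ∂μ) ^ r ≤ ∫ t, star (Z t) * A t ^ r * Z t ∂μ := by
  obtain ⟨Φ, hΦ, hΦA⟩ := exists_support_rpow hr₁ hr₂
    (integral_nonneg (μ := μ) fun t => star_left_conjugate_nonneg (hA t) (Z t))
  calc _ ≤ Φ (∫ t, star (Z t) * A t * Z t ∂μ, ∫ t, star (Z t) * Z t ∂μ) := hΦ _ hZ1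
    _ = ∫ t, Φ (star (Z t) * A t * Z t, star (Z t) * Z t) ∂μ := by
        rw [Φ.integral_comp_comm (hZA.prodMk hZ), integral_pair hZA hZ]
    _ ≤ _ := integral_mono (Φ.integrable_comp (hZA.prodMk hZ)) hZAr
        fun t => hΦA (A t) (Z t) (hA t)

end Jensen

/-- A continuous function on a space with a finite regular measure has almost everywhere separable
range, since the measure is carried by a `σ`-compact set. -/
lemma Continuous.aestronglyMeasurable_of_regular {T E : Type*} [TopologicalSpace T] [T2Space T]
    [MeasurableSpace T] [BorelSpace T] {μ : Measure T} [IsFiniteMeasure μ] [μ.Regular]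
    [TopologicalSpace E] [TopologicalSpace.PseudoMetrizableSpace E] {f : T → E}
    (hf : Continuous f) : AEStronglyMeasurable f μ := by
  borelize E
  rw [aestronglyMeasurable_iff_aemeasurable_separable]
  refine ⟨hf.measurable.aemeasurable, ?_⟩
  have hK : ∀ n : ℕ, ∃ K : Set T, IsCompact K ∧ μ Kᶜ < (n + 1 : ℝ≥0∞)⁻¹ := fun n => by
    obtain ⟨K, -, hK, hμ⟩ := MeasurableSet.univ.exists_isCompact_sdiff_lt (measure_ne_top μ _)
      (ε := (n + 1 : ℝ≥0∞)⁻¹) (by simp)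
    exact ⟨K, hK, by rwa [Set.compl_eq_univ_sdiff]⟩
  choose K hK hμ using hK
  refine ⟨⋃ n, f '' K n, .iUnion fun n => ((hK n).image hf).isSeparable, ?_⟩
  rw [ae_iff, ← nonpos_iff_eq_zero]
  refine ge_of_tendsto' (f := fun n : ℕ => (n + 1 : ℝ≥0∞)⁻¹) (x := Filter.atTop) ?_ fun n => ?_
  · have := (Filter.tendsto_add_atTop_iff_nat 1).2 ENNReal.tendsto_inv_nat_nhds_zero
    simpa using this
  · refine (measure_mono fun t ht hKt => ?_).trans (hμ n).le
    exact ht (Set.mem_iUnion.2 ⟨n, t, hKt, rfl⟩)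

/-! ### Scalar weights and integrability. -/

section Weights

variable {𝒜 : Type*} [CStarAlgebra 𝒜] [PartialOrder 𝒜] [StarOrderedRing 𝒜]

lemma CFC.smul_rpow {c r : ℝ} (hc : 0 ≤ c) (hr : 0 ≤ r) {A : 𝒜} (hA : 0 ≤ A) :
    (c • A) ^ r = c ^ r • A ^ r := by
  have hcont := Real.continuous_rpow_const hr
  rw [CFC.rpow_eq_cfc_real (smul_nonneg hc hA), CFC.rpow_eq_cfc_real hA,
    ← cfc_comp_smul c (fun x : ℝ => x ^ r) A, ← cfc_smul ..]
  refine cfc_congr fun x hx => ?_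
  simp only [smul_eq_mul]
  exact Real.mul_rpow hc (spectrum_nonneg_of_nonneg hA hx)

lemma rpow_one_div_one_sub_rpow {a r : ℝ} (ha : 0 ≤ a) (hr : 1 < r) :
    (a ^ (1 / (1 - r))) ^ (1 - r) = a := by
  rw [← Real.rpow_mul ha, one_div_mul_cancel (by linarith), Real.rpow_one]

/-- The threshold w = a^(1/(1-r)) solves a w^(r-1) = 1: below it the second term suffices, above it
the first. -/
lemma le_mul_rpow_add_rpow {a r x : ℝ} (ha : 0 < a) (hr : 1 < r) (hx : 0 ≤ x) :
    x ≤ a * x ^ r + a ^ (1 / (1 - r)) := by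
  have hw : 0 < a ^ (1 / (1 - r)) := Real.rpow_pos_of_pos ha _
  have hw' := rpow_one_div_one_sub_rpow ha.le hr
  set w := a ^ (1 / (1 - r))
  rcases le_or_gt x w with h | h
  · have : 0 ≤ a * x ^ r := by positivity
    linarith
  · have h1 : 1 ≤ a * x ^ (r - 1) := by
      calc 1 = a * w ^ (r - 1) := by
            rw [← hw', ← Real.rpow_add hw]; norm_num
        _ ≤ a * x ^ (r - 1) := by gcongr
    have h2 : x ^ r = x ^ (r - 1) * x := by
      rw [← Real.rpow_add_one (hw.trans h).ne']; norm_num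
    rw [h2]
    nlinarith

lemma CFC.le_smul_rpow_add {a r : ℝ} (ha : 0 < a) (hr : 1 < r) {A : 𝒜} (hA : 0 ≤ A) :
    A ≤ a • A ^ r + a ^ (1 / (1 - r)) • (1 : 𝒜) := by
  have hcont := Real.continuous_rpow_const (q := r) (by linarith)
  rw [CFC.rpow_eq_cfc_real hA, ← cfc_smul .., ← Algebra.algebraMap_eq_smul_one,
    ← cfc_add_const ..]
  conv_lhs => rw [← cfc_id' ℝ A]
  exact cfc_mono fun x hx => le_mul_rpow_add_rpow ha hr (spectrum_nonneg_of_nonneg hA hx)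

end Weights

/-- In `ENNReal` a negative power of 0 is ∞, whereas the real power used for the weight elsewhere is
finite there. -/
lemma ae_pos_of_lintegral_rpow_lt_top {T : Type*} [MeasurableSpace T] {μ : Measure T} {a : T → ℝ}
    (ha : Measurable a) {p : ℝ} (hp : p < 0) (h : ∫⁻ t, ENNReal.ofReal (a t) ^ p ∂μ < ∞) :
    ∀ᵐ t ∂μ, 0 < a t := by
  filter_upwards [ae_lt_top (by fun_prop) h.ne] with t ht
  by_contra! hn
  simp [ENNReal.ofReal_of_nonpos hn, ENNReal.zero_rpow_of_neg hp] at ht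

lemma integrable_rpow_of_lintegral_lt_top {T : Type*} [MeasurableSpace T] {μ : Measure T}
    {a : T → ℝ} (ha : Measurable a) {p : ℝ} (hp : p < 0)
    (h : ∫⁻ t, ENNReal.ofReal (a t) ^ p ∂μ < ∞) : Integrable (fun t => a t ^ p) μ := by
  refine ⟨(ha.pow_const p).aestronglyMeasurable, ?_⟩
  refine lt_of_le_of_lt (lintegral_mono_ae ?_) h
  filter_upwards [ae_pos_of_lintegral_rpow_lt_top ha hp h] with t ht
  rw [Real.enorm_of_nonneg (by positivity), ENNReal.ofReal_rpow_of_pos ht]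

theorem mainTheorem7
    {T : Type*} [TopologicalSpace T] [LocallyCompactSpace T] [T2Space T]
    [MeasurableSpace T] [BorelSpace T]
    (μ : Measure T) [IsFiniteMeasure μ] [μ.Regular]
    {𝒜 : Type*} [CStarAlgebra 𝒜] [PartialOrder 𝒜] [StarOrderedRing 𝒜]
    (r : ℝ) (hr₁ : 1 < r) (hr₂ : r ≤ 2)
    (a : T → ℝ) (ha_cont : Continuous a) (ha_nonneg : ∀ t, 0 ≤ a t)
    (ha_bdd : ∃ C : ℝ, ∀ t, a t ≤ C)
    -- the integral of the weight, which has the value `∞` where `a` vanishes, is finite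
    (ha_fin : ∫⁻ t, ENNReal.ofReal (a t) ^ (1 / (1 - r)) ∂μ < ∞)
    (X : T → 𝒜) (hX_cont : Continuous X) (hX_bdd : ∃ C : ℝ, ∀ t, ‖X t‖ ≤ C)
    (hX : ∫ t, (a t ^ (1 / (1 - r))) • (star (X t) * X t) ∂μ ≤
      (∫ t, a t ^ (1 / (1 - r)) ∂μ) • (1 : 𝒜))
    (A : T → 𝒜) (hA_cont : Continuous A) (hA_nonneg : ∀ t, 0 ≤ A t)
    -- the integral on the right-hand side exists
    (hA_int : Integrable (fun t => a t • (star (X t) * A t ^ r * X t)) μ) :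
    Integrable (fun t => star (X t) * A t * X t) μ ∧
    (∫ t, star (X t) * A t * X t ∂μ) ^ r ≤
      ((∫ t, a t ^ (1 / (1 - r)) ∂μ) ^ (r - 1)) •
        ∫ t, a t • (star (X t) * A t ^ r * X t) ∂μ := by
  have hp : 1 / (1 - r) < 0 := one_div_neg.2 (by linarith)
  have hr0 : 0 ≤ r := by linarith
  have ha_pos := ae_pos_of_lintegral_rpow_lt_top ha_cont.measurable hp ha_fin
  have hw_int := integrable_rpow_of_lintegral_lt_top ha_cont.measurable hp ha_fin
  have hwX_int : Integrable (fun t => a t ^ (1 / (1 - r)) • (star (X t) * X t)) μ := by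
    obtain ⟨C, hC⟩ := hX_bdd
    refine hw_int.smul_bdd (C * C)
      (Continuous.aestronglyMeasurable_of_regular (by fun_prop)) (.of_forall fun t => ?_)
    rw [CStarRing.norm_star_mul_self]
    have := hC t
    gcongr
    exact (norm_nonneg _).trans this
  have hXA_int : Integrable (fun t => star (X t) * A t * X t) μ := by
    -- Conjugating A ≤ a A^r + w by X dominates X*AX by two integrable terms, as the norm is
    -- monotone on positive elements.
    refine (hA_int.norm.add hwX_int.norm).mono'
      (Continuous.aestronglyMeasurable_of_regular (by fun_prop)) ?_
    filter_upwards [ha_pos] with t ht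
    refine (CStarAlgebra.norm_le_norm_of_nonneg_of_le
      (star_left_conjugate_nonneg (hA_nonneg t) _) ?_).trans (norm_add_le _ _)
    have := star_left_conjugate_le_conjugate (CFC.le_smul_rpow_add ht hr₁ (hA_nonneg t)) (X t)
    simpa only [mul_add, add_mul, mul_smul_comm, smul_mul_assoc, mul_one] using this
  refine ⟨hXA_int, ?_⟩
  set w : T → ℝ := fun t => a t ^ (1 / (1 - r))
  have hw_nonneg : ∀ t, 0 ≤ w t := fun t => Real.rpow_nonneg (ha_nonneg t) _
  have hw_pos : ∀ᵐ t ∂μ, 0 < w t := ha_pos.mono fun t ht => Real.rpow_pos_of_pos ht _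
  change _ ≤ ((∫ t, w t ∂μ) ^ (r - 1)) • _
  change _ ≤ (∫ t, w t ∂μ) • (1 : 𝒜) at hX
  set W := ∫ t, w t ∂μ
  -- As w > 0 almost everywhere, W = 0 forces μ = 0.
  rcases (integral_nonneg hw_nonneg : 0 ≤ W).eq_or_lt with hW | hW
  · have hw0 := (integral_eq_zero_iff_of_nonneg hw_nonneg hw_int).1 hW.symm
    have hμ : μ = 0 := by
      rw [← ae_eq_bot, ← Filter.eventually_false_iff_eq_bot]
      filter_upwards [hw0, hw_pos] with t h0 h1 using h1.ne' h0
    simp only [hμ, integral_zero_measure, smul_zero]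
    exact (CFC.zero_rpow (A := 𝒜) (by linarith : r ≠ 0)).le
  set Z : T → 𝒜 := fun t => √(w t / W) • X t
  have hZ : ∀ t (Y : 𝒜), star (Z t) * Y * Z t = (W⁻¹ * w t) • (star (X t) * Y * X t) := by
    intro t Y
    have : √(w t / W) * √(w t / W) = W⁻¹ * w t := by
      rw [Real.mul_self_sqrt (div_nonneg (hw_nonneg t) hW.le), div_eq_inv_mul]
    simp only [Z, star_smul, star_trivial, smul_mul_assoc, mul_smul_comm, smul_smul, this]
  have hZ1 : (fun t => star (Z t) * Z t) = fun t => W⁻¹ • w t • (star (X t) * X t) := by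
    ext t
    simpa [mul_smul] using hZ t 1
  have hZA : (fun t => star (Z t) * ((w t)⁻¹ • A t) * Z t) =ᵐ[μ]
      fun t => W⁻¹ • (star (X t) * A t * X t) := by
    filter_upwards [hw_pos] with t ht
    rw [hZ, mul_smul_comm, smul_mul_assoc, smul_smul, mul_assoc, mul_inv_cancel₀ ht.ne', mul_one]
  have hZAr : (fun t => star (Z t) * ((w t)⁻¹ • A t) ^ r * Z t) =ᵐ[μ]
      fun t => W⁻¹ • a t • (star (X t) * A t ^ r * X t) := by
    filter_upwards [hw_pos] with t ht
    have : w t * (w t)⁻¹ ^ r = a t := by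
      rw [Real.inv_rpow ht.le, ← Real.rpow_neg ht.le]
      have h : w t ^ (1 - r) = a t := rpow_one_div_one_sub_rpow (ha_nonneg t) hr₁
      rw [← h, sub_eq_add_neg 1 r, Real.rpow_add ht, Real.rpow_one]
    rw [hZ, CFC.smul_rpow (inv_nonneg.2 ht.le) hr0 (hA_nonneg t), mul_smul_comm, smul_mul_assoc,
      smul_smul, mul_assoc, this, mul_smul]
  have key := rpow_integral_conj_le (μ := μ) (Z := Z) (A := fun t => (w t)⁻¹ • A t) hr₁ hr₂
    (fun t => smul_nonneg (inv_nonneg.2 (hw_nonneg t)) (hA_nonneg t))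
    (by rw [hZ1]; exact hwX_int.smul W⁻¹)
    (by
      rw [hZ1, integral_smul]
      refine (smul_le_smul_of_nonneg_left hX (inv_nonneg.2 hW.le)).trans_eq ?_
      rw [inv_smul_smul₀ hW.ne'])
    ((integrable_congr hZA).2 (hXA_int.smul W⁻¹))
    ((integrable_congr hZAr).2 (hA_int.smul W⁻¹))
  rw [integral_congr_ae hZA, integral_congr_ae hZAr, integral_smul, integral_smul,
    CFC.smul_rpow (inv_nonneg.2 hW.le) hr0
      (integral_nonneg fun t => star_left_conjugate_nonneg (hA_nonneg t) _)] at key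
  -- Jensen carries W^(-r) on the left and W⁻¹ on the right; the factor W^r leaves W^(r-1).
  have key2 := smul_le_smul_of_nonneg_left key (Real.rpow_nonneg hW.le r)
  rw [smul_smul, smul_smul, ← Real.mul_rpow hW.le (inv_nonneg.2 hW.le), mul_inv_cancel₀ hW.ne',
    Real.one_rpow, one_smul, ← div_eq_mul_inv, ← Real.rpow_sub_one hW.ne'] at key2
  exact key2
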